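/- Let $V$ be a finite-dimensional real vector space with inner product $\langle\cdot,\cdot\rangle$, let $\Delta\subset V$ be a finite reduced (crystallographic, not necessarily irreducible) root system spanning $V$, with coroots $\alpha^\vee=2\alpha/\langle\alpha,\alpha\rangle$, fundamental system $\Psi=\{\alpha_1,\dots,\alpha_r\}$, positive and negative roots $\Delta_+,\Delta_-$, $n=|\Delta_+|$, and Weyl group $W$. Let $\lambda_i$ and $\lambda_i^\vee$ be the fundamental weights and coweights, $\langle\alpha_i^\vee,\lambda_j\rangle=\delta_{ij}=\langle\lambda_i^\vee,\alpha_j\rangle$, and put $Q=\bigoplus\mathbb Z\alpha_i$, $P=\bigoplus\mathbb Z\lambda_i$, $Q^\vee=\bigoplus\mathbb Z\alpha_i^\vee$, $P^\vee=\bigoplus\mathbb Z\lambda_i^\vee$, $P_{++}=\bigoplus\mathbb Z_{\ge1}\lambda_i$. For $\mathbf s=(s_\alpha)_{\alpha\in\Delta_+}\in\mathbb C^n$, $\mathbf y\in V$ and $f:P/Q\to\mathbb C$ let $$\zeta_r(\mathbf s,\mathbf y,f;\Delta)=\sum_{\lambda\in P_{++}}f(\lambda)e^{2\pi i\langle\mathbf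 y,\lambda\rangle}\prod_{\alpha\in\Delta_+}\frac1{\langle\alpha^\vee,\lambda\rangle^{s_\alpha}}$$ wherever this series converges absolutely, and for $w\in W$ let $w^{-1}\mathbf s=(s_{w\alpha})_{\alpha\in\Delta_+}$, where $s_{-\alpha}:=s_\alpha$. For $\mathbf k\in\mathbb Z_{\ge0}^n$ let $$\mathcal P(\mathbf k,\mathbf y;\Delta)=\int_{[0,1]^{\Delta_+\setminus\Psi}}\prod_{\alpha\in\Delta_+\setminus\Psi}B_{k_\alpha}(x_\alpha)\;\prod_{i=1}^rB_{k_{\alpha_i}}\Bigl(\Bigl\{\langle\mathbf y,\lambda_i\rangle-\sum_{\alpha\in\Delta_+\setminus\Psi}x_\alpha\langle\alpha^\vee,\lambda_i\rangle\Bigr\}\Bigr)\prod_{\alpha\in\Delta_+\setminus\Psi}dx_\alpha,$$ where $B_k$ are the Bernoulli polynomials, $te^{xt}/(e^t-1)=\sum_kB_k(x)t^k/k!$, and $\{\cdot\}$ is the fractional part, and let $$\mathcal P(\mathbf k,\mathbf y,f;\Delta)=\sum_{\mu\in P^\vee/Q^\vee}\widehat f(\mu)\,\mathcal P(\mathbf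 k,\mathbf y+\mu;\Delta),\qquad \widehat f(\mu)=\frac1{|P/Q|}\sum_{\lambda\in P/Q}f(\lambda)e^{-2\pi i\langle\mu,\lambda\rangle}.$$ Theorem. Let $\mathbf k=(k_\alpha)_{\alpha\in\Delta_+}$ be integers with all $k_\alpha\ge2$, let $\mathbf y\in V$ and $f:P/Q\to\mathbb C$. Then for every $w\in W$ the series $\zeta_r(w^{-1}\mathbf k,w^{-1}\mathbf y,f;\Delta)$ converges absolutely, and $$\sum_{w\in W}\Bigl(\prod_{\alpha\in\Delta_+\cap w\Delta_-}(-1)^{k_\alpha}\Bigr)\zeta_r(w^{-1}\mathbf k,w^{-1}\mathbf y,f;\Delta)=(-1)^n\Bigl(\prod_{\alpha\in\Delta_+}\frac{(2\pi\sqrt{-1})^{k_\alpha}}{k_\alpha!}\Bigr)\mathcal P(\mathbf k,\mathbf y,f;\Delta).$$ -/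

import Mathlib

noncomputable section

namespace RootZeta

open RootPairing Module

section

variable {ι V U : Type*} [Finite ι] [AddCommGroup V] [Module ℝ V] [AddCommGroup U] [Module ℝ U]
  {Φ : RootPairing ι ℝ V U}

/-! Throughout, `Φ` is a root system in `V` with coroots in the dual `U` of `V` (in the Euclidean
setting `U = V` and `Φ.toLinearMap` is the inner product), and `b` is a fundamental system of `Φ`.
Roots are indexed by `ι`, the simple roots by `b.support`. -/

/-- The set `Δ₊` of positive roots. -/
abbrev PosRoot (b : Φ.Base) : Type _ := {i : ι // b.IsPos i}

/-- The set `Δ₊ \ Ψ` of positive roots which are not simple. -/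
abbrev NonSimplePosRoot (b : Φ.Base) : Type _ := {i : ι // b.IsPos i ∧ i ∉ b.support}

instance (b : Φ.Base) : Fintype (PosRoot b) := Fintype.ofFinite _

instance (b : Φ.Base) : Fintype (NonSimplePosRoot b) := Fintype.ofFinite _

/-- A simple root as a positive root. -/
def simpleRoot (b : Φ.Base) (i : b.support) : PosRoot b :=
  ⟨i, Base.isPos_of_mem_support i.2⟩

open Classical in
/-- The positive root among `α` and `-α`. -/
def absRoot (b : Φ.Base) (i : ι) : PosRoot b :=
  if h : b.IsPos i then ⟨i, h⟩
  else ⟨Φ.reflectionPerm i i, (Base.IsPos.neg_iff_not b i).2 h⟩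

section Weyl

/-- The action of the Weyl group on families indexed by the positive roots,
`(w s)_α = s_{w⁻¹ α}`, where a negative root is identified with its opposite. -/
def weylAct {X : Type*} (b : Φ.Base) (w : Φ.weylGroup) (s : PosRoot b → X) : PosRoot b → X :=
  fun α ↦ s (absRoot b (w⁻¹ • (α : ι)))

open Classical in
/-- The set `Δ₊ ∩ w Δ₋`. -/
def inversions (b : Φ.Base) (w : Φ.weylGroup) : Finset (PosRoot b) :=
  {α | ∃ β : ι, ¬ b.IsPos β ∧ w • β = (α : ι)}

instance finite_weylGroup [Φ.IsRootSystem] : Finite Φ.weylGroup := by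
  refine Finite.of_injective (fun w : Φ.weylGroup ↦ RootPairing.Equiv.indexHom Φ w) ?_
  intro w₁ w₂ h
  apply Subtype.ext
  apply RootPairing.Equiv.weightHom_injective Φ
  apply LinearEquiv.toLinearMap_injective
  refine LinearMap.ext_on_range (v := Φ.root) IsRootSystem.span_root_eq_top fun i ↦ ?_
  have h₁ := RootPairing.Equiv.root_indexEquiv_eq_smul (P := Φ) i w₁.1
  have h₂ := RootPairing.Equiv.root_indexEquiv_eq_smul (P := Φ) i w₂.1
  have h₃ : w₁.1.toHom.indexEquiv i = w₂.1.toHom.indexEquiv i := DFunLike.congr_fun h i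
  rw [h₃] at h₁
  exact h₁.symm.trans h₂

instance [Φ.IsRootSystem] : Fintype Φ.weylGroup := Fintype.ofFinite _

end Weyl

section Lattices

variable [Φ.IsRootSystem]

open Classical in
/-- The fundamental weights: the basis of `V` dual to the basis of simple coroots. -/
def fundamentalWeight (b : Φ.Base) : Basis b.support ℝ V :=
  b.toCoweightBasis.dualBasis.map Φ.toPerfPair.symm

open Classical in
theorem pairing_fundamentalWeight (b : Φ.Base) (i j : b.support) :
    Φ.toLinearMap (fundamentalWeight b j) (Φ.coroot i) = if i = j then 1 else 0 := by
  have : Φ.toLinearMap (fundamentalWeight b j) = b.toCoweightBasis.dualBasis j := by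
    rw [fundamentalWeight, Basis.map_apply, ← LinearMap.toLinearMap_toPerfPair]
    simp only [LinearEquiv.apply_symm_apply]
  rw [this, ← b.toCoweightBasis_apply i, Basis.dualBasis_apply_self]

/-- The fundamental coweights: the basis of `U` dual to the basis of simple roots. -/
def fundamentalCoweight (b : Φ.Base) : Basis b.support ℝ U :=
  fundamentalWeight b.flip

open Classical in
theorem pairing_fundamentalCoweight (b : Φ.Base) (i j : b.support) :
    Φ.toLinearMap (Φ.root i) (fundamentalCoweight b j) = if i = j then 1 else 0 :=
  pairing_fundamentalWeight b.flip i j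

/-- The weight lattice `P`. -/
def weightLattice (b : Φ.Base) : Submodule ℤ V :=
  Submodule.span ℤ (Set.range (fundamentalWeight b))

/-- The coweight lattice `P^∨`. -/
def coweightLattice (b : Φ.Base) : Submodule ℤ U :=
  Submodule.span ℤ (Set.range (fundamentalCoweight b))

/-- The root lattice `Q`. -/
def rootLattice (b : Φ.Base) : Submodule ℤ V :=
  Submodule.span ℤ (Φ.root '' b.support)

/-- The coroot lattice `Q^∨`. -/
def corootLattice (b : Φ.Base) : Submodule ℤ U :=
  Submodule.span ℤ (Φ.coroot '' b.support)

/-- The finite group `P / Q`. -/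
abbrev WeightQuotient (b : Φ.Base) : Type _ :=
  weightLattice b ⧸ (rootLattice b).submoduleOf (weightLattice b)

/-- The finite group `P^∨ / Q^∨`. -/
abbrev CoweightQuotient (b : Φ.Base) : Type _ :=
  coweightLattice b ⧸ (corootLattice b).submoduleOf (coweightLattice b)

/-- The set `P₊₊` of strongly dominant integral weights, as a subset of `P`. -/
def stronglyDominant (b : Φ.Base) : Set (weightLattice b) :=
  {l | ∃ m : b.support → ℕ, (∀ i, 0 < m i) ∧ (l : V) = ∑ i, m i • fundamentalWeight b i}

theorem rootLattice_le [Φ.IsCrystallographic] (b : Φ.Base) : rootLattice b ≤ weightLattice b := by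
  classical
  refine Submodule.span_le.2 ?_
  rintro _ ⟨i, -, rfl⟩
  have h : Φ.root i = ∑ j : b.support, Φ.pairingIn ℤ i j • fundamentalWeight b j := by
    apply Φ.toPerfPair.injective
    apply b.toCoweightBasis.ext
    intro j
    have := pairing_fundamentalWeight b j
    simp only [Base.toCoweightBasis_apply, map_sum, LinearMap.sum_apply, map_zsmul,
      LinearMap.smul_apply, LinearMap.toPerfPair_apply, this]
    simp [← Φ.algebraMap_pairingIn ℤ]
  rw [h]
  exact Submodule.sum_mem _ fun j _ ↦
    Submodule.smul_mem _ _ (Submodule.subset_span ⟨j, rfl⟩)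

instance finite_weightQuotient [Φ.IsCrystallographic] (b : Φ.Base) :
    Finite (WeightQuotient b) := by
  classical
  let e : Basis b.support ℤ (weightLattice b) := (fundamentalWeight b).restrictScalars ℤ
  have : Module.Free ℤ (weightLattice b) := .of_basis e
  have : Module.Finite ℤ (weightLattice b) := .of_basis e
  apply Submodule.finiteQuotientOfFreeOfRankEq
  rw [(Submodule.submoduleOfEquivOfLe (rootLattice_le b)).finrank_eq,
    Module.finrank_eq_card_basis e, rootLattice, b.span_int_root_support]
  exact Module.finrank_eq_card_basis b.toWeightBasisInt

instance finite_coweightQuotient [Φ.IsCrystallographic] (b : Φ.Base) :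
    Finite (CoweightQuotient b) :=
  finite_weightQuotient b.flip

instance [Φ.IsCrystallographic] (b : Φ.Base) : Fintype (WeightQuotient b) := Fintype.ofFinite _

instance [Φ.IsCrystallographic] (b : Φ.Base) : Fintype (CoweightQuotient b) := Fintype.ofFinite _

theorem pairing_int_of_mem_weightLattice (b : Φ.Base) {v : V} (hv : v ∈ weightLattice b) {u : U}
    (hu : u ∈ corootLattice b) : ∃ n : ℤ, Φ.toLinearMap v u = n := by
  classical
  induction hv using Submodule.span_induction with
  | mem v hv =>
    obtain ⟨j, rfl⟩ := hv
    induction hu using Submodule.span_induction with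
    | mem u hu =>
      obtain ⟨i, hi, rfl⟩ := hu
      refine ⟨if (⟨i, hi⟩ : b.support) = j then 1 else 0, ?_⟩
      rw [pairing_fundamentalWeight b ⟨i, hi⟩ j]
      split_ifs <;> simp
    | zero => exact ⟨0, by simp⟩
    | add x y _ _ hx hy =>
      obtain ⟨m, hm⟩ := hx
      obtain ⟨n, hn⟩ := hy
      exact ⟨m + n, by simp [hm, hn]⟩
    | smul a x _ hx =>
      obtain ⟨m, hm⟩ := hx
      exact ⟨a * m, by simp [hm]⟩
  | zero => exact ⟨0, by simp⟩
  | add x y _ _ hx hy =>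
    obtain ⟨m, hm⟩ := hx
    obtain ⟨n, hn⟩ := hy
    exact ⟨m + n, by simp [hm, hn]⟩
  | smul a x _ hx =>
    obtain ⟨m, hm⟩ := hx
    exact ⟨a * m, by simp [hm]⟩

theorem pairing_int_of_mem_coweightLattice (b : Φ.Base) {u : U} (hu : u ∈ coweightLattice b)
    {v : V} (hv : v ∈ rootLattice b) : ∃ n : ℤ, Φ.toLinearMap v u = n :=
  pairing_int_of_mem_weightLattice b.flip hu hv

/-- The pairing `e^{2πi⟨μ, λ⟩}` of `μ ∈ P^∨ / Q^∨` and `λ ∈ P / Q`. -/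
def character (b : Φ.Base) (μ : CoweightQuotient b) (l : WeightQuotient b) : ℂ :=
  Quotient.liftOn₂' μ l
    (fun μ l ↦ Complex.exp (2 * Real.pi * Complex.I * (Φ.toLinearMap (l : V) (μ : U) : ℝ)))
    (by
      intro μ l μ' l' hμ hl
      rw [Submodule.quotientRel_def] at hμ hl
      obtain ⟨m, hm⟩ := pairing_int_of_mem_weightLattice b l.2 hμ
      obtain ⟨n, hn⟩ := pairing_int_of_mem_coweightLattice b μ'.2 hl
      refine Complex.exp_eq_exp_iff_exists_int.2 ⟨m + n, ?_⟩
      have h : Φ.toLinearMap (l : V) (μ : U) = Φ.toLinearMap (l' : V) (μ' : U) + (m + n) := by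
        rw [← hm, ← hn]
        simp
      rw [h]
      push_cast
      ring)

end Lattices

section Zeta

variable [Φ.IsRootSystem]

/-- The term `f(λ) e^{2πi⟨y, λ⟩} ∏_{α ∈ Δ₊} ⟨α^∨, λ⟩^{-s_α}` of the zeta-function. -/
def zetaTerm (b : Φ.Base) (s : PosRoot b → ℂ) (y : U) (f : WeightQuotient b → ℂ)
    (l : weightLattice b) : ℂ :=
  f (Submodule.Quotient.mk l)
    * Complex.exp (2 * Real.pi * Complex.I * (Φ.toLinearMap (l : V) y : ℝ))
    * ∏ α : PosRoot b, 1 / ((Φ.toLinearMap (l : V) (Φ.coroot α) : ℝ) : ℂ) ^ s α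

/-- The zeta-function `ζ_r(s, y, f; Δ)` as a series over `P₊₊`. -/
def zeta (b : Φ.Base) (s : PosRoot b → ℂ) (y : U) (f : WeightQuotient b → ℂ) : ℂ :=
  ∑' l : stronglyDominant b, zetaTerm b s y f l

end Zeta

section Bernoulli

variable [Φ.IsRootSystem]

/-- The periodic Bernoulli function `𝒫(k, y; Δ)`. -/
def periodicBernoulli (b : Φ.Base) (k : PosRoot b → ℕ) (y : U) : ℝ :=
  ∫ x in Set.Icc (0 : NonSimplePosRoot b → ℝ) 1,
    (∏ α : NonSimplePosRoot b, bernoulliFun (k ⟨α, α.2.1⟩) (x α)) *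
      ∏ i : b.support, bernoulliFun (k (simpleRoot b i))
        (Int.fract (Φ.toLinearMap (fundamentalWeight b i) y -
          ∑ α : NonSimplePosRoot b,
            x α * Φ.toLinearMap (fundamentalWeight b i) (Φ.coroot α)))

theorem periodicBernoulli_add (b : Φ.Base) (k : PosRoot b → ℕ) (y : U) {a : U}
    (ha : a ∈ corootLattice b) : periodicBernoulli b k (y + a) = periodicBernoulli b k y := by
  have h (i : b.support) (t : ℝ) :
      Int.fract (Φ.toLinearMap (fundamentalWeight b i) (y + a) - t) =
        Int.fract (Φ.toLinearMap (fundamentalWeight b i) y - t) := by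
    obtain ⟨n, hn⟩ := pairing_int_of_mem_weightLattice b
      (v := fundamentalWeight b i) (Submodule.subset_span ⟨i, rfl⟩) ha
    rw [map_add, hn, add_sub_right_comm, Int.fract_add_intCast]
  simp only [periodicBernoulli, h]

/-- `𝒫(k, y + μ; Δ)` for a class `μ ∈ P^∨ / Q^∨`. -/
def periodicBernoulliShift (b : Φ.Base) (k : PosRoot b → ℕ) (y : U)
    (μ : CoweightQuotient b) : ℝ :=
  Quotient.liftOn' μ (fun μ ↦ periodicBernoulli b k (y + μ))
    (by
      intro μ μ' h
      rw [Submodule.quotientRel_def] at h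
      have : y + (μ : U) = y + (μ' : U) + ((μ - μ' : coweightLattice b) : U) := by
        rw [AddSubgroupClass.coe_sub]; abel
      rw [this]
      exact periodicBernoulli_add b k _ h)

variable [Φ.IsCrystallographic]

/-- The Fourier coefficient
`f̂(μ) = |P / Q|⁻¹ ∑_{λ ∈ P / Q} f(λ) e^{-2πi⟨μ, λ⟩}`. -/
def fourierCoeff (b : Φ.Base) (f : WeightQuotient b → ℂ) (μ : CoweightQuotient b) : ℂ :=
  (1 / (Fintype.card (WeightQuotient b) : ℂ)) *
    ∑ l : WeightQuotient b, f l * (character b μ l)⁻¹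

/-- The generalized Bernoulli function
`𝒫(k, y, f; Δ) = ∑_{μ ∈ P^∨ / Q^∨} f̂(μ) 𝒫(k, y + μ; Δ)`. -/
def generalizedBernoulli (b : Φ.Base) (k : PosRoot b → ℕ) (y : U)
    (f : WeightQuotient b → ℂ) : ℂ :=
  ∑ μ : CoweightQuotient b, fourierCoeff b f μ * (periodicBernoulliShift b k y μ : ℂ)

end Bernoulli

end

end RootZeta

end

set_option linter.unusedSectionVars false

/-! ### Fourier expansion of Bernoulli functions, and sums over `ℤ^I` of inverse powers of linear
forms. -/

namespace RootZeta

section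

open MeasureTheory Complex

/-! Both sides evaluate one absolutely convergent sum over the whole weight lattice, that of `f(λ)
e^{2πi⟨y,λ⟩} ∏ ⟨α^∨,λ⟩^{-k_α}`, where the convention `1 / 0 = 0` removes every weight on a wall.

By Weyl orbits: the regular weights are the disjoint union of the translates `w P₊₊`
(`exists_smul_pos`, `eq_one_of_pos_of_smul_pos`). Pulled back by `w`, the term becomes a zeta term
for `w⁻¹k`, `w⁻¹y`, with one sign `(-1)^{k_α}` for each positive root that `w⁻¹` makes negative; `f`
is unaffected because `W` acts trivially on `P/Q` (`mul_latticeTerm_smul`).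

By Fourier series: in the coordinates `m_i = ⟨α_i^∨,λ⟩` the simple roots give the Fourier series of
Bernoulli functions, while each remaining factor is, up to a constant, the Fourier coefficient `∫
B_k(x) e^{-2πinx} dx` at `n = ⟨α^∨,λ⟩`. Summing under the integral produces `𝒫(k, y; Δ)`
(`hasSum_exp_mul_prod_one_div_pow`, `hasSum_latticeTerm`). Fourier inversion for the pairing of
`P/Q` with `P^∨/Q^∨` then brings in `f` (`sum_fourierCoeff_mul_character`). -/

theorem hasSum_mul_complex {X Y : Type*} {f : X → ℂ} {g : Y → ℂ} {a b : ℂ} (hf : HasSum f a)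
    (hg : HasSum g b) : HasSum (fun p : X × Y ↦ f p.1 * g p.2) (a * b) :=
  hf.mul hg (summable_mul_of_summable_norm (R := ℂ) hf.summable.norm hg.summable.norm)

theorem hasSum_prod_fin {β : Type*} (n : ℕ) {f : Fin n → β → ℂ} {a : Fin n → ℂ}
    (ha : ∀ i, HasSum (f i) (a i)) :
    HasSum (fun m : Fin n → β ↦ ∏ i, f i (m i)) (∏ i, a i) := by
  induction n with
  | zero => simp
  | succ n ih =>
    have h := hasSum_mul_complex (ha 0) (ih fun i ↦ ha i.succ)
    rw [Fin.prod_univ_succ, ← (Fin.consEquiv fun _ ↦ β).hasSum_iff]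
    refine h.congr_fun fun m ↦ ?_
    simp [Fin.prod_univ_succ, Fin.consEquiv]

theorem hasSum_prod_pi {I β : Type*} [Fintype I] {f : I → β → ℂ} {a : I → ℂ}
    (ha : ∀ i, HasSum (f i) (a i)) :
    HasSum (fun m : I → β ↦ ∏ i, f i (m i)) (∏ i, a i) := by
  have e := (Fintype.equivFin I).symm
  obtain ⟨E, hE⟩ : ∃ E : (I → β) ≃ (Fin (Fintype.card I) → β), ∀ m i, E m i = m (e i) :=
    ⟨e.symm.arrowCongr (.refl β), fun _ _ ↦ rfl⟩
  have h := hasSum_prod_fin _ fun i ↦ ha (e i)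
  rw [← e.prod_comp a]
  refine (E.hasSum_iff.2 h).congr_fun fun m ↦ ?_
  simp only [Function.comp_apply, hE]
  exact (e.prod_comp fun i ↦ f i (m i)).symm

/-- The case `n = 0` is included: `B_k` has mean zero for `k ≥ 1`, which agrees with `1 / 0 = 0`.
This is why walls need no separate treatment in the lattice sum. -/
theorem integral_bernoulliFun_mul_exp {k : ℕ} (hk : k ≠ 0) (n : ℤ) :
    ∫ x in Set.Icc (0 : ℝ) 1, (bernoulliFun k x : ℂ) * exp (-(2 * Real.pi * I * n * x)) =
      -k.factorial / (2 * Real.pi * I * n) ^ k := by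
  rw [← bernoulliFourierCoeff_eq hk, bernoulliFourierCoeff, fourierCoeffOn_eq_integral,
    integral_Icc_eq_integral_Ioc, intervalIntegral.integral_of_le zero_le_one]
  simp only [sub_zero, div_one, one_smul]
  refine integral_congr_ae (ae_of_all _ fun x ↦ ?_)
  simp only [smul_eq_mul]
  rw [mul_comm]
  congr 2
  simp
  ring

theorem hasSum_exp_div_pow {k : ℕ} (hk : 2 ≤ k) (t : ℝ) :
    HasSum (fun n : ℤ ↦ 1 / (n : ℂ) ^ k * exp (2 * Real.pi * I * n * t))
      (-(2 * Real.pi * I) ^ k / k.factorial * bernoulliFun k (Int.fract t)) := by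
  refine (hasSum_one_div_pow_mul_fourier_mul_bernoulliFun hk
    ⟨Int.fract_nonneg t, (Int.fract_lt_one t).le⟩).congr_fun fun n ↦ ?_
  have h : 2 * (Real.pi : ℂ) * I * n * t =
      2 * Real.pi * I * n * Int.fract t + (n * ⌊t⌋ : ℤ) * (2 * Real.pi * I) := by
    nth_rw 1 [← Int.fract_add_floor t]
    push_cast
    ring
  rw [h, exp_add, exp_int_mul_two_pi_mul_I, mul_one, fourier_coe_apply]
  simp

section

variable {I J : Type*} [Fintype I] [Fintype J] (a : J → I → ℤ) (p : I → ℕ) (q : J → ℕ)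
  (t : I → ℝ)

/-- A term of the expansion of the integrand of `periodicBernoulli`. -/
noncomputable def integrandTerm (m : I → ℤ) (x : J → ℝ) : ℂ :=
  (∏ j, (bernoulliFun (q j) (x j) : ℂ)) *
    ∏ i, (1 / (m i : ℂ) ^ p i *
      exp (2 * Real.pi * Complex.I * m i * (t i - ∑ j, x j * a j i : ℝ)))

theorem norm_integrandTerm (m : I → ℤ) (x : J → ℝ) :
    ‖integrandTerm a p q t m x‖ =
      ‖∏ j, (bernoulliFun (q j) (x j) : ℂ)‖ * ‖∏ i, 1 / (m i : ℂ) ^ p i‖ := by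
  have h (i : I) (s : ℝ) : ‖exp (2 * Real.pi * Complex.I * m i * s)‖ = 1 := by
    rw [← norm_exp_ofReal_mul_I (2 * Real.pi * m i * s)]
    congr 2
    push_cast
    ring
  simp only [integrandTerm, norm_mul, norm_prod, h, mul_one]

/-- Grouping the exponent by `j` instead of by `i` separates the variables, so that the integral
over the cube splits into one-dimensional ones. -/
theorem integrandTerm_eq (m : I → ℤ) (x : J → ℝ) :
    integrandTerm a p q t m x =
      (exp (2 * Real.pi * Complex.I * (∑ i, m i * t i : ℝ)) * ∏ i, 1 / (m i : ℂ) ^ p i) *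
      ∏ j, ((bernoulliFun (q j) (x j) : ℂ) *
        exp (-(2 * Real.pi * Complex.I * (∑ i, m i * a j i : ℤ) * x j))) := by
  simp only [integrandTerm, Finset.prod_mul_distrib, ← exp_sum]
  have h : ∑ i, 2 * (Real.pi : ℂ) * Complex.I * m i * (t i - ∑ j, x j * a j i : ℝ) =
      2 * Real.pi * Complex.I * (∑ i, m i * t i : ℝ) +
      ∑ j, -(2 * Real.pi * Complex.I * (∑ i, m i * a j i : ℤ) * x j) := by
    have h' : ∑ j, 2 * (Real.pi : ℂ) * Complex.I * (∑ i, m i * a j i : ℤ) * x j =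
        ∑ i, ∑ j, 2 * (Real.pi : ℂ) * Complex.I * m i * (x j * a j i) := by
      rw [Finset.sum_comm]
      refine Finset.sum_congr rfl fun j _ ↦ ?_
      push_cast
      rw [Finset.mul_sum, Finset.sum_mul]
      exact Finset.sum_congr rfl fun _ _ ↦ by ring
    rw [Finset.sum_neg_distrib, h', ← sub_eq_add_neg]
    push_cast
    rw [Finset.mul_sum, ← Finset.sum_sub_distrib]
    refine Finset.sum_congr rfl fun i _ ↦ ?_
    rw [mul_sub, Finset.mul_sum]
    ring
  rw [h, exp_add]
  ring

theorem continuous_integrandTerm (m : I → ℤ) : Continuous (integrandTerm a p q t m) := by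
  unfold integrandTerm
  have := continuous_bernoulliFun
  fun_prop

variable {p q}

theorem integral_integrandTerm (hq : ∀ j, q j ≠ 0) (m : I → ℤ) :
    ∫ x in Set.Icc (0 : J → ℝ) 1, integrandTerm a p q t m x =
      (exp (2 * Real.pi * Complex.I * (∑ i, m i * t i : ℝ)) * ∏ i, 1 / (m i : ℂ) ^ p i) *
      ∏ j, (-(q j).factorial / (2 * Real.pi * Complex.I * (∑ i, m i * a j i : ℤ)) ^ q j) := by
  simp only [integrandTerm_eq]
  rw [integral_const_mul, ← Set.pi_univ_Icc, volume_pi, Measure.restrict_pi_pi,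
    integral_fintype_prod_eq_prod (f := fun j (x : ℝ) ↦ (bernoulliFun (q j) x : ℂ) *
        exp (-(2 * Real.pi * Complex.I * (∑ i, m i * a j i : ℤ) * x)))]
  congr 1
  exact Finset.prod_congr rfl fun j _ ↦ integral_bernoulliFun_mul_exp (hq j) _

theorem hasSum_integrandTerm (hp : ∀ i, 2 ≤ p i) (x : J → ℝ) :
    HasSum (fun m ↦ integrandTerm a p q t m x)
      ((∏ i, -(2 * Real.pi * Complex.I) ^ p i / ((p i).factorial : ℂ)) *
        (((∏ j, bernoulliFun (q j) (x j)) *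
          ∏ i, bernoulliFun (p i) (Int.fract (t i - ∑ j, x j * a j i)) : ℝ) : ℂ)) := by
  have := (hasSum_prod_pi
    fun i ↦ hasSum_exp_div_pow (hp i) (t i - ∑ j, x j * a j i)).mul_left
      (∏ j, (bernoulliFun (q j) (x j) : ℂ))
  convert! this using 1
  rw [Finset.prod_mul_distrib]
  push_cast
  ring

/-- Integrate the product of Fourier series term by term. The exponentials have modulus one, so the
norms of the terms are dominated by `∏ |m_i|^{-p_i}`, summable because `p_i ≥ 2`. -/
theorem hasSum_exp_mul_prod_one_div_pow (hp : ∀ i, 2 ≤ p i) (hq : ∀ j, 2 ≤ q j) :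
    HasSum (fun m : I → ℤ ↦ exp (2 * Real.pi * Complex.I * (∑ i, m i * t i : ℝ)) *
        ((∏ i, 1 / (m i : ℂ) ^ p i) * ∏ j, 1 / ((∑ i, m i * a j i : ℤ) : ℂ) ^ q j))
      ((∏ i, -(2 * Real.pi * Complex.I) ^ p i / ((p i).factorial : ℂ)) *
        (∏ j, -(2 * Real.pi * Complex.I) ^ q j / ((q j).factorial : ℂ)) *
        ((∫ x in Set.Icc (0 : J → ℝ) 1, (∏ j, bernoulliFun (q j) (x j)) *
          ∏ i, bernoulliFun (p i) (Int.fract (t i - ∑ j, x j * a j i)) : ℝ) : ℂ)) := by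
  -- The Fourier series at `t = 0`, where every exponential is one.
  have hs : Summable fun m : I → ℤ ↦ ‖∏ i, 1 / (m i : ℂ) ^ p i‖ := by
    have := (hasSum_prod_pi fun i ↦ hasSum_exp_div_pow (hp i) 0).summable.norm
    simpa using this
  have h := hasSum_integral_of_summable_integral_norm
    (μ := volume.restrict (Set.Icc (0 : J → ℝ) 1)) (F := integrandTerm a p q t)
    (fun m ↦ ((continuous_integrandTerm a p q t m).continuousOn.integrableOn_compact
      isCompact_Icc)) (by
      simp only [norm_integrandTerm, integral_mul_const]
      exact hs.mul_left _)
  simp only [(hasSum_integrandTerm a t hp _).tsum_eq, integral_const_mul,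
    integral_complex_ofReal,
    integral_integrandTerm a t fun j ↦ (Nat.lt_of_lt_of_le two_pos (hq j)).ne'] at h
  -- This constant cancels the `-q!/(2πi)^q` contributed by each Fourier coefficient.
  have h' := h.mul_left (∏ j, -(2 * Real.pi * Complex.I) ^ q j / ((q j).factorial : ℂ))
  have h0 : (2 * Real.pi * Complex.I : ℂ) ≠ 0 := by simp [Real.pi_ne_zero]
  convert! h' using 1
  · funext m
    rw [mul_left_comm (∏ j, -_ / _), ← Finset.prod_mul_distrib, ← mul_assoc]
    congr 1
    refine Finset.prod_congr rfl fun j _ ↦ ?_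
    have := (q j).factorial_ne_zero
    have hz := pow_ne_zero (q j) h0
    rw [mul_pow (2 * Real.pi * Complex.I : ℂ) ((∑ i, m i * a j i : ℤ) : ℂ)]
    generalize (2 * Real.pi * Complex.I : ℂ) ^ q j = w at hz ⊢
    field_simp
  · ring

end

end

end RootZeta

/-! ### The Weyl group: exchange property, action on weights, simple transitivity on chambers. -/

namespace RootZeta

section

open RootPairing Module

section

variable {ι V U : Type*} [AddCommGroup V] [Module ℝ V] [AddCommGroup U] [Module ℝ U]
  {Φ : RootPairing ι ℝ V U}

theorem root_smul (g : Φ.Aut) (i : ι) : Φ.root (g • i) = g • Φ.root i :=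
  RootPairing.Equiv.root_indexEquiv_eq_smul Φ i g

theorem pairing_smul_coroot_smul (g : Φ.Aut) (v : V) (i : ι) :
    Φ.toLinearMap (g • v) (Φ.coroot (g • i)) = Φ.toLinearMap v (Φ.coroot i) := by
  have h₁ := LinearMap.congr_fun (LinearMap.congr_fun g.weight_coweight_transpose
    (Φ.coroot (g • i))) v
  have h₂ : g.coweightMap (Φ.coroot (g • i)) = Φ.coroot i := by
    rw [RootPairing.Hom.coroot_coweightMap_apply]
    exact congrArg _ (g.indexEquiv.symm_apply_apply i)
  rw [← h₂]
  exact h₁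

theorem reflection_smul_index (i j : ι) :
    RootPairing.Equiv.reflection Φ i • j = Φ.reflectionPerm i j := rfl

theorem smul_reflectionPerm_self (g : Φ.Aut) (i : ι) :
    g • Φ.reflectionPerm i i = Φ.reflectionPerm (g • i) (g • i) := by
  apply Φ.root.injective
  rw [root_smul]
  rw [Φ.root_reflectionPerm, Φ.root_reflectionPerm, Φ.reflection_apply_self,
    Φ.reflection_apply_self, root_smul, smul_neg]

theorem conj_reflection [Φ.IsRootSystem] (g : Φ.Aut) (i : ι) :
    g * RootPairing.Equiv.reflection Φ i * g⁻¹ = RootPairing.Equiv.reflection Φ (g • i) := by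
  apply RootPairing.Equiv.weightHom_injective Φ
  ext v
  change g • (Φ.reflection i (g⁻¹ • v)) = Φ.reflection (g • i) v
  rw [Φ.reflection_apply, Φ.reflection_apply, smul_sub, smul_inv_smul, smul_comm, root_smul]
  congr 2
  have := pairing_smul_coroot_smul g (g⁻¹ • v) i
  rw [smul_inv_smul] at this
  exact this.symm

theorem isPos_reflectionPerm_self (b : Φ.Base) (i : ι) :
    b.IsPos (Φ.reflectionPerm i i) ↔ ¬ b.IsPos i :=
  Base.IsPos.neg_iff_not b i

variable [Finite ι] [Φ.IsRootSystem] [Φ.IsCrystallographic] [Φ.IsReduced] (b : Φ.Base)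

theorem simpleReflection_smul_isPos {i j : ι} (hj : j ∈ b.support) (hi : b.IsPos i)
    (hij : i ≠ j) : b.IsPos (RootPairing.Equiv.reflection Φ j • i) :=
  hi.reflectionPerm hj hij

/-- The product of the simple reflections indexed by a list. -/
noncomputable def simpleProd (L : List b.support) : Φ.Aut :=
  (L.map fun i ↦ RootPairing.Equiv.reflection Φ (i : ι)).prod

/-- Simple reflections carry simple roots to all roots, and conjugation carries the reflection in
`α` to the one in `gα`. -/
theorem exists_simpleProd_eq_reflection (i : ι) :
    ∃ L, simpleProd b L = RootPairing.Equiv.reflection Φ i := by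
  refine b.induction_reflect i
    (p := fun i ↦ ∃ L, simpleProd b L = RootPairing.Equiv.reflection Φ i)
    (fun i ⟨L, hL⟩ ↦ ⟨L, ?_⟩) (fun i hi ↦ ⟨[⟨i, hi⟩], ?_⟩)
    fun i j ⟨L, hL⟩ hj ↦ ⟨⟨j, hj⟩ :: L ++ [⟨j, hj⟩], ?_⟩
  · rw [hL, ← reflection_smul_index, ← conj_reflection, mul_inv_cancel_right]
  · simp [simpleProd]
  · rw [← reflection_smul_index, ← conj_reflection, ← hL]
    simp [simpleProd]

theorem exists_simpleProd_eq {g : Φ.Aut} (hg : g ∈ Φ.weylGroup) : ∃ L, simpleProd b L = g := by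
  induction hg using RootPairing.weylGroup.induction with
  | mem i => exact exists_simpleProd_eq_reflection b i
  | one => exact ⟨[], rfl⟩
  | mul x y _ _ hx hy =>
    obtain ⟨L, rfl⟩ := hx
    obtain ⟨L', rfl⟩ := hy
    exact ⟨L ++ L', by simp [simpleProd]⟩

/-- The exchange condition. Applied letter by letter from the right, the word turns `α_j` negative
at some letter `a`. Since `s_a` makes no positive root but its own negative, the letters `u` after
`a` send `α_j` to that root; hence `s_a = u s_j u⁻¹`, and `s_a u s_j = u` deletes the letter. -/
theorem exists_simpleProd_eq_mul_reflection (L : List b.support) (j : b.support)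
    (h : ¬ b.IsPos (simpleProd b L • (j : ι))) :
    ∃ L' : List b.support, L'.length + 1 = L.length ∧
      simpleProd b L * RootPairing.Equiv.reflection Φ (j : ι) = simpleProd b L' := by
  induction L with
  | nil => exact absurd (Base.isPos_of_mem_support j.2) (by simpa [simpleProd] using h)
  | cons a L ih =>
    have hcons (L : List b.support) : simpleProd b (a :: L) =
      RootPairing.Equiv.reflection Φ (a : ι) * simpleProd b L := by simp [simpleProd]
    by_cases hL : b.IsPos (simpleProd b L • (j : ι))
    · refine ⟨L, rfl, ?_⟩
      have ha : simpleProd b L • (j : ι) = a := by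
        by_contra hne
        rw [hcons, mul_smul] at h
        exact h (simpleReflection_smul_isPos b a.2 hL hne)
      rw [hcons, ← ha, ← conj_reflection, inv_mul_cancel_right, mul_assoc]
      nth_rw 1 [← RootPairing.Equiv.reflection_inv]
      rw [inv_mul_cancel, mul_one]
    · obtain ⟨L', h₁, h₂⟩ := ih hL
      exact ⟨a :: L', by simp [h₁], by rw [hcons, hcons, mul_assoc, h₂]⟩

/-- If a shortest word for `g` ended in `s_j`, the prefix would send `α_j` to `-gα_j`, a negative
root, and the exchange condition would give a shorter word. -/
theorem eq_one_of_forall_isPos {g : Φ.Aut} (hg : g ∈ Φ.weylGroup)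
    (h : ∀ i, b.IsPos i → b.IsPos (g • i)) : g = 1 := by
  classical
  have hex : ∃ n, ∃ L, simpleProd b L = g ∧ L.length = n := by
    obtain ⟨L, hL⟩ := exists_simpleProd_eq b hg
    exact ⟨_, L, hL, rfl⟩
  obtain ⟨L, hL, hn⟩ := Nat.find_spec hex
  rcases L.eq_nil_or_concat with rfl | ⟨L, j, rfl⟩
  · simpa [simpleProd] using hL.symm
  have hg' : g = simpleProd b L * RootPairing.Equiv.reflection Φ (j : ι) := by
    rw [← hL]; simp [simpleProd]
  have hneg : ¬ b.IsPos (simpleProd b L • (j : ι)) := by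
    have hj := h _ (Base.isPos_of_mem_support j.2)
    rwa [hg', mul_smul, reflection_smul_index, smul_reflectionPerm_self,
      isPos_reflectionPerm_self] at hj
  obtain ⟨L', h₁, h₂⟩ := exists_simpleProd_eq_mul_reflection b L j hneg
  have := Nat.find_min' hex ⟨L', by rw [hg', h₂], rfl⟩
  simp at hn
  omega


/-- A reflection moves `v` by an integral multiple of a root. Thus the Weyl group acts trivially on
`P/Q`. -/
theorem smul_sub_mem_rootLattice {g : Φ.Aut} (hg : g ∈ Φ.weylGroup) {v : V}
    (hv : v ∈ weightLattice b) : g • v - v ∈ rootLattice b := by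
  induction hg using RootPairing.weylGroup.induction generalizing v with
  | mem i =>
    have hi : Φ.coroot i ∈ corootLattice b := b.coroot_mem_span_int i
    obtain ⟨n, hn⟩ := pairing_int_of_mem_weightLattice b hv hi
    have : RootPairing.Equiv.reflection Φ i • v - v = (-n : ℤ) • Φ.root i := by
      rw [RootPairing.Equiv.reflection_smul, Φ.reflection_apply]
      change v - Φ.toLinearMap v (Φ.coroot i) • Φ.root i - v = _
      rw [hn, Int.cast_smul_eq_zsmul]
      simp
    rw [this]
    exact Submodule.smul_mem _ _ (b.root_mem_span_int i)
  | one => simp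
  | mul x y hx hy hx' hy' =>
    have hyv : y • v ∈ weightLattice b := by
      simpa using add_mem (rootLattice_le b (hy' hv)) hv
    rw [mul_smul, ← sub_add_sub_cancel]
    exact add_mem (hx' hyv) (hy' hv)

theorem smul_mem_weightLattice {g : Φ.Aut} (hg : g ∈ Φ.weylGroup) {v : V}
    (hv : v ∈ weightLattice b) : g • v ∈ weightLattice b := by
  simpa using add_mem (rootLattice_le b (smul_sub_mem_rootLattice b hg hv)) hv

/-- Maximise the pairing with the sum of the fundamental coweights over the orbit. That sum pairs to
one with each simple root, so applying `s_i` lowers the value by `⟨gv, α_i^∨⟩`, which is therefore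
nonnegative; regularity makes it nonzero. -/
theorem exists_smul_pos {v : V} (hv : ∀ i, Φ.toLinearMap v (Φ.coroot i) ≠ 0) :
    ∃ g : Φ.weylGroup, ∀ i ∈ b.support, 0 < Φ.toLinearMap (g • v) (Φ.coroot i) := by
  classical
  obtain ⟨g, hg⟩ := Finite.exists_max fun g : Φ.weylGroup ↦
    Φ.toLinearMap (g • v) (∑ j, fundamentalCoweight b j)
  refine ⟨g, fun i hi ↦ lt_of_le_of_ne ?_ ?_⟩
  · have h₁ := hg (weylGroup.ofIdx Φ i * g)
    have h₂ : Φ.toLinearMap (Φ.root i) (∑ j, fundamentalCoweight b j) = 1 := by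
      have := pairing_fundamentalCoweight b ⟨i, hi⟩
      simp only at this
      simp [map_sum, this]
    have h₃ : (weylGroup.ofIdx Φ i * g) • v =
        g • v - Φ.toLinearMap (g • v) (Φ.coroot i) • Φ.root i := by
      rw [mul_smul, weylGroup.ofIdx_smul, RootPairing.Equiv.reflection_smul, Φ.reflection_apply]
      rfl
    rw [h₃, LinearMap.map_sub, LinearMap.sub_apply, LinearMap.map_smul, LinearMap.smul_apply,
      h₂] at h₁
    simpa using h₁
  · have := pairing_smul_coroot_smul (g : Φ.Aut) v ((g : Φ.Aut)⁻¹ • i)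
    rw [smul_inv_smul] at this
    exact fun h ↦ hv _ (this.symm.trans h.symm)

end

section

variable {ι V : Type*} [Finite ι] [NormedAddCommGroup V] [InnerProductSpace ℝ V]
  {Φ : RootPairing ι ℝ V V} [Φ.IsRootSystem] [Φ.IsCrystallographic] [Φ.IsReduced]

theorem inner_smul_smul (hpairing : ∀ u v : V, Φ.toLinearMap u v = inner ℝ u v)
    (hcoroot : ∀ i, Φ.coroot i = (2 / inner ℝ (Φ.root i) (Φ.root i)) • Φ.root i)
    {g : Φ.Aut} (hg : g ∈ Φ.weylGroup) (u v : V) :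
    inner ℝ (g • u) (g • v) = (inner ℝ u v : ℝ) := by
  induction hg using RootPairing.weylGroup.induction generalizing u v with
  | mem i =>
    have h0 : (inner ℝ (Φ.root i) (Φ.root i) : ℝ) ≠ 0 := inner_self_ne_zero.2 (Φ.ne_zero i)
    have (x : V) : RootPairing.Equiv.reflection Φ i • x = x -
        (2 / inner ℝ (Φ.root i) (Φ.root i) * inner ℝ x (Φ.root i)) • Φ.root i := by
      rw [RootPairing.Equiv.reflection_smul, Φ.reflection_apply]
      change x - Φ.toLinearMap x (Φ.coroot i) • Φ.root i = _
      rw [hpairing, hcoroot, real_inner_smul_right]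
    simp only [this, inner_sub_left, inner_sub_right, real_inner_smul_left,
      real_inner_smul_right, real_inner_comm (Φ.root i)]
    field_simp
    ring
  | one => simp
  | mul x y _ _ hx hy => rw [mul_smul, mul_smul, hx, hy]

/-- A coroot is a positive multiple of its root, and a positive root is reached by adding simple
roots one at a time. -/
theorem pairing_coroot_pos (hpairing : ∀ u v : V, Φ.toLinearMap u v = inner ℝ u v)
    (hcoroot : ∀ i, Φ.coroot i = (2 / inner ℝ (Φ.root i) (Φ.root i)) • Φ.root i)
    (b : Φ.Base) {v : V} (hv : ∀ i ∈ b.support, 0 < Φ.toLinearMap v (Φ.coroot i))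
    {i : ι} (hi : b.IsPos i) : 0 < Φ.toLinearMap v (Φ.coroot i) := by
  have key (i : ι) : 0 < Φ.toLinearMap v (Φ.coroot i) ↔ (0 : ℝ) < inner ℝ v (Φ.root i) := by
    have h0 : (0 : ℝ) < inner ℝ (Φ.root i) (Φ.root i) := real_inner_self_pos.2 (Φ.ne_zero i)
    rw [hpairing, hcoroot, real_inner_smul_right, mul_pos_iff_of_pos_left (by positivity)]
  rw [key]
  refine hi.induction_on_add (p := fun i ↦ (0 : ℝ) < inner ℝ v (Φ.root i))
    (fun j hj ↦ (key j).1 (hv j hj)) fun i j k h hi hj ↦ ?_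
  rw [h, inner_add_right]
  exact add_pos hi ((key j).1 (hv j hj))

/-- If `g` made a positive root `α` negative, then `⟨gv, (gα)^∨⟩ = ⟨v, α^∨⟩` would be both negative
and positive. -/
theorem eq_one_of_pos_of_smul_pos (hpairing : ∀ u v : V, Φ.toLinearMap u v = inner ℝ u v)
    (hcoroot : ∀ i, Φ.coroot i = (2 / inner ℝ (Φ.root i) (Φ.root i)) • Φ.root i)
    (b : Φ.Base) {v : V} (hv : ∀ i ∈ b.support, 0 < Φ.toLinearMap v (Φ.coroot i))
    {g : Φ.weylGroup} (hg : ∀ i ∈ b.support, 0 < Φ.toLinearMap (g • v) (Φ.coroot i)) :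
    g = 1 := by
  apply Subtype.ext
  refine eq_one_of_forall_isPos b g.2 fun i hi ↦ ?_
  by_contra hneg
  rw [← isPos_reflectionPerm_self] at hneg
  have h₁ := pairing_coroot_pos hpairing hcoroot b hv hi
  have h₂ := pairing_coroot_pos hpairing hcoroot b hg hneg
  rw [Φ.coroot_reflectionPerm, Φ.coreflection_apply_self, map_neg] at h₂
  have h₃ := pairing_smul_coroot_smul (g : Φ.Aut) v i
  have h₄ : Φ.toLinearMap (g • v) (Φ.coroot ((g : Φ.Aut) • i)) = _ := h₃
  linarith

end

end

end RootZeta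

/-! ### Duality and Fourier inversion between `P/Q` and `P^∨/Q^∨`. -/

namespace RootZeta

section

open RootPairing Module

section

variable {ι V U : Type*} [Finite ι] [AddCommGroup V] [Module ℝ V] [AddCommGroup U] [Module ℝ U]
  {Φ : RootPairing ι ℝ V U} [Φ.IsRootSystem] (b : Φ.Base)

theorem character_mk (μ : coweightLattice b) (l : weightLattice b) :
    character b (Submodule.Quotient.mk μ) (Submodule.Quotient.mk l) =
      Complex.exp (2 * Real.pi * Complex.I * (Φ.toLinearMap (l : V) (μ : U) : ℝ)) := rfl

theorem character_add_left (μ ν : CoweightQuotient b) (l : WeightQuotient b) :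
    character b (μ + ν) l = character b μ l * character b ν l := by
  induction μ using Submodule.Quotient.induction_on with | H μ => ?_
  induction ν using Submodule.Quotient.induction_on with | H ν => ?_
  induction l using Submodule.Quotient.induction_on with | H l => ?_
  rw [← Submodule.Quotient.mk_add, character_mk, character_mk, character_mk, ← Complex.exp_add]
  simp [mul_add]

theorem character_add_right (μ : CoweightQuotient b) (l l' : WeightQuotient b) :
    character b μ (l + l') = character b μ l * character b μ l' := by
  induction μ using Submodule.Quotient.induction_on with | H μ => ?_
  induction l using Submodule.Quotient.induction_on with | H l => ?_
  induction l' using Submodule.Quotient.induction_on with | H l' => ?_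
  rw [← Submodule.Quotient.mk_add, character_mk, character_mk, character_mk, ← Complex.exp_add]
  simp [mul_add]

theorem character_zero_left (l : WeightQuotient b) : character b 0 l = 1 := by
  induction l using Submodule.Quotient.induction_on with | H l => ?_
  rw [← Submodule.Quotient.mk_zero, character_mk]
  simp

theorem character_zero_right (μ : CoweightQuotient b) : character b μ 0 = 1 := by
  induction μ using Submodule.Quotient.induction_on with | H μ => ?_
  rw [← Submodule.Quotient.mk_zero, character_mk]
  simp

theorem character_ne_zero (μ : CoweightQuotient b) (l : WeightQuotient b) :
    character b μ l ≠ 0 := by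
  intro h
  have := character_add_right b μ l (-l)
  rw [add_neg_cancel, character_zero_right, h, zero_mul] at this
  exact one_ne_zero this

/-- The pairing of `P^∨ / Q^∨` and `P / Q` as a family of characters of `P^∨ / Q^∨`. -/
noncomputable def coweightChar (l : WeightQuotient b) : AddChar (CoweightQuotient b) ℂ where
  toFun μ := character b μ l
  map_zero_eq_one' := character_zero_left b l
  map_add_eq_mul' μ ν := character_add_left b μ ν l

/-- Pairing with the fundamental coweights reads off the coordinates in the simple roots, and a
trivial character forces these to be integers. -/
theorem eq_zero_of_forall_character_eq_one {l : WeightQuotient b}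
    (h : ∀ μ, character b μ l = 1) : l = 0 := by
  classical
  induction l using Submodule.Quotient.induction_on with | H l => ?_
  rw [Submodule.Quotient.mk_eq_zero]
  change (l : V) ∈ rootLattice b
  have hint (i : b.support) : ∃ n : ℤ, Φ.toLinearMap (l : V) (fundamentalCoweight b i) = n := by
    have h₁ := h (Submodule.Quotient.mk ⟨fundamentalCoweight b i,
      Submodule.subset_span ⟨i, rfl⟩⟩)
    rw [character_mk, Complex.exp_eq_one_iff] at h₁
    obtain ⟨n, hn⟩ := h₁
    refine ⟨n, ?_⟩
    have h0 : (2 * Real.pi * Complex.I : ℂ) ≠ 0 := by simp [Real.pi_ne_zero]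
    rw [mul_comm (n : ℂ)] at hn
    exact_mod_cast mul_left_cancel₀ h0 hn
  choose n hn using hint
  have hl : (l : V) = ∑ i, n i • Φ.root i := by
    apply Φ.toPerfPair.injective
    apply (fundamentalCoweight b).ext
    intro j
    have := fun i ↦ pairing_fundamentalCoweight b i j
    simp only [map_sum, LinearMap.sum_apply, map_zsmul, LinearMap.smul_apply,
      LinearMap.toPerfPair_apply, this, hn]
    simp
  rw [hl]
  exact Submodule.sum_mem _ fun i _ ↦
    Submodule.smul_mem _ _ (Submodule.subset_span ⟨i, i.2, rfl⟩)

theorem coweightChar_injective : Function.Injective (coweightChar b) := by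
  intro l l' h
  rw [← sub_eq_zero]
  refine eq_zero_of_forall_character_eq_one b fun μ ↦ ?_
  have h₁ : character b μ l = character b μ l' := DFunLike.congr_fun h μ
  have h₂ := character_add_right b μ (l - l') l'
  rw [sub_add_cancel, h₁] at h₂
  exact (mul_eq_right₀ (character_ne_zero b μ l')).1 h₂.symm

variable [Φ.IsCrystallographic]

theorem card_weightQuotient_le :
    Nat.card (WeightQuotient b) ≤ Nat.card (CoweightQuotient b) := by
  have : Nat.card (AddChar (CoweightQuotient b) ℂ) = Nat.card (CoweightQuotient b) := by
    rw [Nat.card_eq_fintype_card, Nat.card_eq_fintype_card, AddChar.card_eq]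
  rw [← this]
  exact Nat.card_le_card_of_injective _ (coweightChar_injective b)

/-- The inequality from counting characters is applied to the root system and to its dual. -/
theorem card_weightQuotient_eq :
    Nat.card (WeightQuotient b) = Nat.card (CoweightQuotient b) :=
  le_antisymm (card_weightQuotient_le b) (card_weightQuotient_le b.flip)

/-- Orthogonality of characters summed over `P^∨/Q^∨` yields the order of that group, whereas `f̂`
is normalised by `|P/Q|`; the equality of the two orders reconciles them. -/
theorem sum_fourierCoeff_mul_character (f : WeightQuotient b → ℂ) (l : WeightQuotient b) :
    ∑ μ, fourierCoeff b f μ * character b μ l = f l := by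
  classical
  have hsum (l' : WeightQuotient b) : ∑ μ, (character b μ l')⁻¹ * character b μ l =
      if l' = l then (Fintype.card (WeightQuotient b) : ℂ) else 0 := by
    have h₁ (μ : CoweightQuotient b) :
        (character b μ l')⁻¹ * character b μ l = coweightChar b (l - l') μ := by
      have h₂ := character_add_right b μ (l - l') l'
      rw [sub_add_cancel] at h₂
      rw [h₂, mul_comm, mul_inv_cancel_right₀ (character_ne_zero b μ l')]
      rfl
    have h₀ : coweightChar b 0 = 0 := by
      ext μ
      exact character_zero_right b μ
    simp only [h₁, AddChar.sum_eq_ite, ← h₀, (coweightChar_injective b).eq_iff, sub_eq_zero,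
      eq_comm (a := l), ← Nat.card_eq_fintype_card, card_weightQuotient_eq]
  have hc : (Fintype.card (WeightQuotient b) : ℂ) ≠ 0 :=
    Nat.cast_ne_zero.2 Fintype.card_ne_zero
  simp only [fourierCoeff, mul_assoc, Finset.sum_mul]
  rw [← Finset.mul_sum, Finset.sum_comm]
  simp only [← Finset.mul_sum, hsum]
  simp
  field_simp

end

end

end RootZeta

/-! ### The sum over the weight lattice as a generalized Bernoulli function. -/

namespace RootZeta

section

open RootPairing Module

section

variable {ι V U : Type*} [Finite ι] [AddCommGroup V] [Module ℝ V] [AddCommGroup U] [Module ℝ U]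
  {Φ : RootPairing ι ℝ V U} [Φ.IsRootSystem] (b : Φ.Base)

theorem prod_posRoot (F : PosRoot b → ℂ) :
    ∏ α, F α = (∏ i : b.support, F (simpleRoot b i)) *
      ∏ j : NonSimplePosRoot b, F ⟨j, j.2.1⟩ := by
  classical
  let g : b.support ⊕ NonSimplePosRoot b → PosRoot b :=
    Sum.elim (simpleRoot b) fun j ↦ ⟨j, j.2.1⟩
  have hg : Function.Bijective g := by
    constructor
    · rintro (i | i) (j | j) h
      · exact congrArg _ (Subtype.ext (congrArg (fun α : PosRoot b ↦ (α : ι)) h))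
      · have h' : (i : ι) = j := congrArg (fun α : PosRoot b ↦ (α : ι)) h
        exact absurd (h' ▸ i.2) j.2.2
      · have h' : (i : ι) = j := congrArg (fun α : PosRoot b ↦ (α : ι)) h
        exact absurd (h' ▸ j.2) i.2.2
      · exact congrArg _ (Subtype.ext (congrArg (fun α : PosRoot b ↦ (α : ι)) h))
    · rintro ⟨i, hi⟩
      by_cases h : i ∈ b.support
      · exact ⟨.inl ⟨i, h⟩, rfl⟩
      · exact ⟨.inr ⟨i, hi, h⟩, rfl⟩
  rw [← hg.prod_comp F, Fintype.prod_sum_type]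
  rfl

/-- The term `e^{2πi⟨y, v⟩} ∏_{α ∈ Δ₊} ⟨α^∨, v⟩^{-k_α}`, which vanishes if `v` lies on a wall. -/
noncomputable def latticeTerm (k : PosRoot b → ℕ) (y : U) (v : V) : ℂ :=
  Complex.exp (2 * Real.pi * Complex.I * (Φ.toLinearMap v y : ℝ)) *
    ∏ α : PosRoot b, 1 / ((Φ.toLinearMap v (Φ.coroot α) : ℝ) : ℂ) ^ k α

theorem latticeTerm_add (k : PosRoot b → ℕ) (y : U) (μ : coweightLattice b)
    (l : weightLattice b) :
    latticeTerm b k (y + μ) l =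
      latticeTerm b k y l * character b (Submodule.Quotient.mk μ) (Submodule.Quotient.mk l) := by
  have h : Φ.toLinearMap (l : V) (y + μ) = Φ.toLinearMap (l : V) y + Φ.toLinearMap (l : V) μ :=
    map_add _ _ _
  rw [latticeTerm, latticeTerm, character_mk, h, Complex.ofReal_add, mul_add, Complex.exp_add]
  ring

theorem hasSum_latticeTerm (k : PosRoot b → ℕ) (hk : ∀ α, 2 ≤ k α) (y : U) :
    HasSum (fun l : weightLattice b ↦ latticeTerm b k y l)
      ((∏ α, -(2 * Real.pi * Complex.I) ^ k α / ((k α).factorial : ℂ)) *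
        (periodicBernoulli b k y : ℂ)) := by
  classical
  let E : (b.support → ℤ) ≃ weightLattice b :=
    ((fundamentalWeight b).restrictScalars ℤ).equivFun.symm.toEquiv
  have hE (m : b.support → ℤ) : (E m : V) = ∑ i, m i • fundamentalWeight b i := by
    change ((((fundamentalWeight b).restrictScalars ℤ).equivFun.symm m : weightLattice b) : V) = _
    rw [Basis.equivFun_symm_apply, Submodule.coe_sum]
    exact Finset.sum_congr rfl fun i _ ↦ by
      rw [Submodule.coe_smul, Basis.restrictScalars_apply]
  have hint (α : ι) (i : b.support) :
      ∃ n : ℤ, Φ.toLinearMap (fundamentalWeight b i) (Φ.coroot α) = n :=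
    pairing_int_of_mem_weightLattice b (Submodule.subset_span ⟨i, rfl⟩)
      (b.coroot_mem_span_int α)
  choose a ha using hint
  have hEu (m : b.support → ℤ) (u : U) : Φ.toLinearMap (E m : V) u =
      ∑ i, m i * Φ.toLinearMap (fundamentalWeight b i) u := by
    simp [hE, map_sum, LinearMap.sum_apply]
  have h := hasSum_exp_mul_prod_one_div_pow
    (fun (j : NonSimplePosRoot b) i ↦ a j i)
    (fun i ↦ Φ.toLinearMap (fundamentalWeight b i) y)
    (p := fun i ↦ k (simpleRoot b i)) (q := fun j : NonSimplePosRoot b ↦ k ⟨j, j.2.1⟩)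
    (fun _ ↦ hk _) fun _ ↦ hk _
  rw [← prod_posRoot b fun α ↦ -(2 * Real.pi * Complex.I) ^ k α / ((k α).factorial : ℂ)] at h
  rw [← E.hasSum_iff, periodicBernoulli]
  simp only [ha]
  refine h.congr_fun fun m ↦ ?_
  simp only [Function.comp_apply, latticeTerm, hEu, prod_posRoot b, ha]
  congr 2
  -- A simple coroot pairs with the weight to give a single coordinate `m i`.
  · refine Finset.prod_congr rfl fun i _ ↦ ?_
    have := pairing_fundamentalWeight b i
    simp only [← ha, simpleRoot, this]
    simp
  · refine Finset.prod_congr rfl fun i _ ↦ ?_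
    push_cast
    rfl

variable [Φ.IsCrystallographic]

theorem hasSum_mul_latticeTerm (k : PosRoot b → ℕ) (hk : ∀ α, 2 ≤ k α) (y : U)
    (f : WeightQuotient b → ℂ) :
    HasSum (fun l : weightLattice b ↦ f (Submodule.Quotient.mk l) * latticeTerm b k y l)
      ((∏ α, -(2 * Real.pi * Complex.I) ^ k α / ((k α).factorial : ℂ)) *
        generalizedBernoulli b k y f) := by
  have h (μ : CoweightQuotient b) : HasSum (fun l : weightLattice b ↦
      fourierCoeff b f μ * (latticeTerm b k y l * character b μ (Submodule.Quotient.mk l)))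
      (fourierCoeff b f μ *
        ((∏ α, -(2 * Real.pi * Complex.I) ^ k α / ((k α).factorial : ℂ)) *
          (periodicBernoulliShift b k y μ : ℂ))) := by
    refine HasSum.mul_left _ ?_
    induction μ using Submodule.Quotient.induction_on with | H μ => ?_
    simp only [← latticeTerm_add]
    exact hasSum_latticeTerm b k hk (y + μ)
  convert! hasSum_sum (s := Finset.univ) fun μ _ ↦ h μ using 1
  · funext l
    rw [← sum_fourierCoeff_mul_character b f, Finset.sum_mul]
    exact Finset.sum_congr rfl fun _ _ ↦ by ring
  · rw [generalizedBernoulli, Finset.mul_sum]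
    exact Finset.sum_congr rfl fun _ _ ↦ by ring

/-! ### Weyl action up to sign, and decomposition of the weight lattice into orbits. -/

theorem absRoot_of_isPos {i : ι} (h : b.IsPos i) : absRoot b i = ⟨i, h⟩ := dif_pos h

theorem coe_absRoot_of_not_isPos {i : ι} (h : ¬ b.IsPos i) :
    (absRoot b i : ι) = Φ.reflectionPerm i i := by
  rw [absRoot, dif_neg h]

theorem absRoot_reflectionPerm_self (i : ι) :
    absRoot b (Φ.reflectionPerm i i) = absRoot b i := by
  by_cases h : b.IsPos i
  · have h' : ¬ b.IsPos (Φ.reflectionPerm i i) := by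
      rwa [isPos_reflectionPerm_self, not_not]
    apply Subtype.ext
    rw [coe_absRoot_of_not_isPos b h', absRoot_of_isPos b h]
    apply Φ.root.injective
    rw [Φ.root_reflectionPerm, Φ.reflection_apply_self, Φ.root_reflectionPerm,
      Φ.reflection_apply_self, neg_neg]
  · apply Subtype.ext
    rw [coe_absRoot_of_not_isPos b h, absRoot_of_isPos b ((isPos_reflectionPerm_self b i).2 h)]

theorem absRoot_smul_absRoot (g : Φ.Aut) (i : ι) :
    absRoot b (g • (absRoot b i : ι)) = absRoot b (g • i) := by
  by_cases h : b.IsPos i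
  · rw [absRoot_of_isPos b h]
  · rw [coe_absRoot_of_not_isPos b h, smul_reflectionPerm_self, absRoot_reflectionPerm_self]

/-- The permutation of the positive roots induced by a Weyl group element up to sign. -/
noncomputable def absPerm (g : Φ.Aut) : PosRoot b ≃ PosRoot b where
  toFun α := absRoot b (g • (α : ι))
  invFun α := absRoot b (g⁻¹ • (α : ι))
  left_inv α := by
    change absRoot b (g⁻¹ • (absRoot b (g • (α : ι)) : ι)) = α
    rw [absRoot_smul_absRoot, inv_smul_smul, absRoot_of_isPos b α.2]
  right_inv α := by
    change absRoot b (g • (absRoot b (g⁻¹ • (α : ι)) : ι)) = α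
    rw [absRoot_smul_absRoot, smul_inv_smul, absRoot_of_isPos b α.2]

theorem pairing_coroot_absRoot (v : V) (i : ι) [Decidable (b.IsPos i)] :
    Φ.toLinearMap v (Φ.coroot (absRoot b i)) =
      (if b.IsPos i then 1 else -1) * Φ.toLinearMap v (Φ.coroot i) := by
  split_ifs with h
  · rw [absRoot_of_isPos b h, one_mul]
  · rw [coe_absRoot_of_not_isPos b h, Φ.coroot_reflectionPerm, Φ.coreflection_apply_self, map_neg,
      neg_one_mul]

theorem mem_inversions (w : Φ.weylGroup) (α : PosRoot b) :
    α ∈ inversions b w ↔ ¬ b.IsPos ((w : Φ.Aut)⁻¹ • (α : ι)) := by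
  simp only [inversions, Finset.mem_filter, Finset.mem_univ, true_and]
  constructor
  · rintro ⟨β, hβ, h⟩
    rw [← h]
    change ¬ b.IsPos ((w : Φ.Aut)⁻¹ • (w : Φ.Aut) • β)
    rwa [inv_smul_smul]
  · intro h
    exact ⟨_, h, smul_inv_smul (w : Φ.Aut) (α : ι)⟩

/-- Invariance gives `⟨wv, α^∨⟩ = ⟨v, (w⁻¹α)^∨⟩`. Replacing `w⁻¹α` by the positive root among
`±w⁻¹α` permutes the factors and costs a sign exactly at the inversions. -/
theorem prod_one_div_pairing_smul (w : Φ.weylGroup) (k : PosRoot b → ℕ) (v : V) :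
    ∏ α : PosRoot b, 1 / ((Φ.toLinearMap ((w : Φ.Aut) • v) (Φ.coroot α) : ℝ) : ℂ) ^ k α =
      (∏ α ∈ inversions b w, (-1 : ℂ) ^ k α) *
        ∏ α : PosRoot b, 1 / ((Φ.toLinearMap v (Φ.coroot α) : ℝ) : ℂ) ^ weylAct b w⁻¹ k α := by
  classical
  have h₁ : ∏ α ∈ inversions b w, (-1 : ℂ) ^ k α =
      ∏ α : PosRoot b, if b.IsPos ((w : Φ.Aut)⁻¹ • (α : ι)) then 1 else (-1 : ℂ) ^ k α := by
    rw [← Finset.prod_subset (Finset.subset_univ (inversions b w))]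
    · exact Finset.prod_congr rfl fun α hα ↦ by rw [if_neg ((mem_inversions b w α).1 hα)]
    · intro α _ hα
      rw [mem_inversions, not_not] at hα
      rw [if_pos hα]
  rw [← (absPerm b (w : Φ.Aut)⁻¹).prod_comp fun α ↦
    1 / ((Φ.toLinearMap v (Φ.coroot α) : ℝ) : ℂ) ^ weylAct b w⁻¹ k α, h₁, ← Finset.prod_mul_distrib]
  refine Finset.prod_congr rfl fun α _ ↦ ?_
  have h₂ : weylAct b w⁻¹ k (absPerm b (w : Φ.Aut)⁻¹ α) = k α := by
    rw [weylAct, inv_inv]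
    exact congrArg k ((absPerm b (w : Φ.Aut)).apply_symm_apply α)
  have h₃ := pairing_smul_coroot_smul (w : Φ.Aut) v ((w : Φ.Aut)⁻¹ • (α : ι))
  rw [smul_inv_smul] at h₃
  have h₄ := pairing_coroot_absRoot b v ((w : Φ.Aut)⁻¹ • (α : ι))
  rw [h₂, h₃]
  change _ = _ *
    (1 / ((Φ.toLinearMap v (Φ.coroot (absRoot b ((w : Φ.Aut)⁻¹ • (α : ι)))) : ℝ) : ℂ) ^ k α)
  rw [h₄]
  split_ifs
  · simp
  · have : ((-1 : ℂ) ^ k α) * (-1) ^ k α = 1 := by rw [← mul_pow]; simp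
    push_cast
    rw [mul_pow, one_div, one_div, mul_inv, ← mul_assoc]
    rw [eq_comm, mul_inv_cancel₀ (pow_ne_zero _ (by norm_num)), one_mul]

end

section

variable {ι V : Type*} [Finite ι] [NormedAddCommGroup V] [InnerProductSpace ℝ V]
  {Φ : RootPairing ι ℝ V V} [Φ.IsRootSystem] [Φ.IsCrystallographic] [Φ.IsReduced]

theorem mul_latticeTerm_smul (hpairing : ∀ u v : V, Φ.toLinearMap u v = inner ℝ u v)
    (hcoroot : ∀ i, Φ.coroot i = (2 / inner ℝ (Φ.root i) (Φ.root i)) • Φ.root i)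
    (b : Φ.Base) (k : PosRoot b → ℕ) (y : V) (f : WeightQuotient b → ℂ) (w : Φ.weylGroup)
    (l : weightLattice b) :
    f (Submodule.Quotient.mk ⟨(w : Φ.Aut) • (l : V), smul_mem_weightLattice b w.2 l.2⟩) *
        latticeTerm b k y ((w : Φ.Aut) • (l : V)) =
      (∏ α ∈ inversions b w, (-1 : ℂ) ^ k α) *
        zetaTerm b (fun α ↦ ((weylAct b w⁻¹ k α : ℕ) : ℂ)) (w⁻¹ • y) f l := by
  have h₁ : (Submodule.Quotient.mk ⟨(w : Φ.Aut) • (l : V), smul_mem_weightLattice b w.2 l.2⟩ :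
      WeightQuotient b) = Submodule.Quotient.mk l := by
    rw [Submodule.Quotient.eq]
    exact smul_sub_mem_rootLattice b w.2 l.2
  have h₂ : Φ.toLinearMap ((w : Φ.Aut) • (l : V)) y = Φ.toLinearMap (l : V) (w⁻¹ • y) := by
    rw [hpairing, hpairing, ← inner_smul_smul hpairing hcoroot w.2 (l : V)]
    congr 1
    exact (smul_inv_smul w y).symm
  simp only [h₁, latticeTerm, h₂, prod_one_div_pairing_smul, zetaTerm, Complex.cpow_natCast]
  ring

theorem pairing_pos_of_mem_stronglyDominant (b : Φ.Base) {l : weightLattice b}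
    (hl : l ∈ stronglyDominant b) :
    ∀ i ∈ b.support, 0 < Φ.toLinearMap (l : V) (Φ.coroot i) := by
  classical
  intro i hi
  obtain ⟨m, hm, h⟩ := hl
  have := pairing_fundamentalWeight b ⟨i, hi⟩
  simp only at this
  rw [h]
  simpa [map_sum, LinearMap.sum_apply, this] using hm ⟨i, hi⟩

theorem mem_stronglyDominant_of_pairing_pos (b : Φ.Base) {l : weightLattice b}
    (hl : ∀ i ∈ b.support, 0 < Φ.toLinearMap (l : V) (Φ.coroot i)) :
    l ∈ stronglyDominant b := by
  classical
  have hint (i : b.support) : ∃ n : ℕ, 0 < n ∧ Φ.toLinearMap (l : V) (Φ.coroot i) = n := by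
    obtain ⟨n, hn⟩ := pairing_int_of_mem_weightLattice b l.2
      (Submodule.subset_span ⟨i, i.2, rfl⟩ : Φ.coroot i ∈ corootLattice b)
    have h := hl i i.2
    rw [hn] at h
    have h' : 0 < n := by exact_mod_cast h
    lift n to ℕ using h'.le
    exact ⟨n, by exact_mod_cast h', by simpa using hn⟩
  choose m hm hm' using hint
  refine ⟨m, hm, ?_⟩
  apply Φ.toPerfPair.injective
  apply b.toCoweightBasis.ext
  intro j
  have := pairing_fundamentalWeight b j
  simp only [Base.toCoweightBasis_apply, map_sum, LinearMap.sum_apply, map_nsmul,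
    LinearMap.smul_apply, LinearMap.toPerfPair_apply, this, hm']
  simp

/-- The map `W × P₊₊ → P` given by the action of the Weyl group. -/
noncomputable def weylOrbitMap (b : Φ.Base) (p : Φ.weylGroup × stronglyDominant b) :
    weightLattice b :=
  ⟨(p.1 : Φ.Aut) • ((p.2 : weightLattice b) : V), smul_mem_weightLattice b p.1.2 p.2.1.2⟩

theorem weylOrbitMap_injective (hpairing : ∀ u v : V, Φ.toLinearMap u v = inner ℝ u v)
    (hcoroot : ∀ i, Φ.coroot i = (2 / inner ℝ (Φ.root i) (Φ.root i)) • Φ.root i)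
    (b : Φ.Base) : Function.Injective (weylOrbitMap b) := by
  rintro ⟨w, l⟩ ⟨w', l'⟩ h
  have h₁ : w • (l.1 : V) = w' • (l'.1 : V) := congrArg Subtype.val h
  have h₂ : (w'⁻¹ * w) • (l.1 : V) = l'.1 := by rw [mul_smul, h₁, inv_smul_smul]
  have h₃ : w'⁻¹ * w = 1 := by
    refine eq_one_of_pos_of_smul_pos hpairing hcoroot b
      (pairing_pos_of_mem_stronglyDominant b l.2) ?_
    rw [h₂]
    exact pairing_pos_of_mem_stronglyDominant b l'.2
  rw [h₃, one_smul] at h₂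
  exact Prod.ext (inv_mul_eq_one.1 h₃).symm (Subtype.ext (Subtype.ext h₂))

/-- A regular weight can be moved into the open chamber, so a weight missed by the orbits lies on a
wall, where one factor is `1 / 0 ^ k = 0` as `k > 0`. -/
theorem latticeTerm_eq_zero_of_notMem_range (b : Φ.Base) {k : PosRoot b → ℕ}
    (hk : ∀ α, 2 ≤ k α) (y : V) {l : weightLattice b} (hl : l ∉ Set.range (weylOrbitMap b)) :
    latticeTerm b k y l = 0 := by
  classical
  have h : ∃ i, Φ.toLinearMap (l : V) (Φ.coroot i) = 0 := by
    by_contra! h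
    obtain ⟨g, hg⟩ := exists_smul_pos b h
    refine hl ⟨(g⁻¹, ⟨⟨g • (l : V), smul_mem_weightLattice b g.2 l.2⟩,
      mem_stronglyDominant_of_pairing_pos b hg⟩), Subtype.ext ?_⟩
    exact inv_smul_smul g (l : V)
  obtain ⟨i, hi⟩ := h
  have h₁ := pairing_coroot_absRoot b (l : V) i
  rw [hi, mul_zero] at h₁
  rw [latticeTerm, Finset.prod_eq_zero (Finset.mem_univ (absRoot b i)), mul_zero]
  rw [h₁, Complex.ofReal_zero, zero_pow (Nat.lt_of_lt_of_le two_pos (hk _)).ne', div_zero]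

end

end

end RootZeta

theorem mainTheorem2 {ι V : Type*} [Finite ι] [NormedAddCommGroup V] [InnerProductSpace ℝ V]
    (Φ : RootPairing ι ℝ V V) [Φ.IsRootSystem] [Φ.IsCrystallographic] [Φ.IsReduced]
    (hpairing : ∀ u v : V, Φ.toLinearMap u v = inner ℝ u v)
    (hcoroot : ∀ i, Φ.coroot i = (2 / inner ℝ (Φ.root i) (Φ.root i)) • Φ.root i)
    (b : Φ.Base) (k : RootZeta.PosRoot b → ℕ) (hk : ∀ α, 2 ≤ k α) (y : V)
    (f : RootZeta.WeightQuotient b → ℂ) :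
    (∀ w : Φ.weylGroup, Summable fun l : RootZeta.stronglyDominant b ↦
      RootZeta.zetaTerm b (fun α ↦ ((RootZeta.weylAct b w⁻¹ k α : ℕ) : ℂ)) (w⁻¹ • y) f l) ∧
    ∑ w : Φ.weylGroup, (∏ α ∈ RootZeta.inversions b w, (-1 : ℂ) ^ k α) *
        RootZeta.zeta b (fun α ↦ ((RootZeta.weylAct b w⁻¹ k α : ℕ) : ℂ)) (w⁻¹ • y) f =
      (-1) ^ Fintype.card (RootZeta.PosRoot b) *
        (∏ α : RootZeta.PosRoot b,
          (2 * Real.pi * Complex.I) ^ k α / (Nat.factorial (k α) : ℂ)) *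
        RootZeta.generalizedBernoulli b k y f := by
  classical
  let S (w : Φ.weylGroup) : ℂ := ∏ α ∈ RootZeta.inversions b w, (-1 : ℂ) ^ k α
  have hS (w : Φ.weylGroup) : S w ≠ 0 := Finset.prod_ne_zero_iff.2 fun _ _ ↦ by simp
  -- The sum over `P` is reindexed by `W × P₊₊`: the orbit map is injective, and the terms outside
  -- its range vanish.
  have h := (RootZeta.weylOrbitMap_injective hpairing hcoroot b).hasSum_iff (fun l hl ↦ by
    rw [RootZeta.latticeTerm_eq_zero_of_notMem_range b hk y hl, mul_zero]) |>.2
    (RootZeta.hasSum_mul_latticeTerm b k hk y f)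
  replace h := h.congr_fun (g := fun p : Φ.weylGroup × RootZeta.stronglyDominant b ↦
      S p.1 * RootZeta.zetaTerm b (fun α ↦ ((RootZeta.weylAct b p.1⁻¹ k α : ℕ) : ℂ))
        (p.1⁻¹ • y) f p.2)
    fun p ↦ (RootZeta.mul_latticeTerm_smul hpairing hcoroot b k y f p.1 p.2).symm
  -- Each zeta series is, up to the nonzero sign `S w`, a slice of the summable family over `W ×
  -- P₊₊`.
  have hsum (w : Φ.weylGroup) : Summable fun l : RootZeta.stronglyDominant b ↦
      RootZeta.zetaTerm b (fun α ↦ ((RootZeta.weylAct b w⁻¹ k α : ℕ) : ℂ)) (w⁻¹ • y) f l :=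
    (summable_mul_left_iff (hS w)).1 (h.summable.prod_factor w)
  refine ⟨hsum, ?_⟩
  have h' := h.prod_fiberwise fun w ↦ (hsum w).hasSum.mul_left (S w)
  refine (hasSum_fintype _).unique h' |>.trans ?_
  congr 1
  -- The factor `(-1)^n` collects one minus sign from each Bernoulli expansion, that is, from each
  -- positive root.
  rw [Fintype.card, ← Finset.prod_const, ← Finset.prod_mul_distrib]
  exact Finset.prod_congr rfl fun _ _ ↦ by ring
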